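/- Let $\kappa$ be an uncountable cardinal and let $U$ be a normal measure on $\kappa$, i.e. a nonprincipal $\kappa$-complete ultrafilter on $\kappa$ closed under diagonal intersections. Let $P$ be the Prikry forcing associated with $U$: its conditions are the pairs $\langle t,C\rangle$ with $t\subset\kappa$ finite, $C\in U$ and $\max t<\min C$, and $\langle t,C\rangle\le\langle s,D\rangle$ iff $t$ end-extends $s$, $t\setminus s\subseteq D$ and $C\subseteq D$. Let $RO(P)$ be the complete Boolean algebra of regular open subsets of $P$. A regular subalgebra of a complete Boolean algebra $B$ is a Boolean subalgebra of $B$ closed under all suprema computed in $B$. A forcing notion is called trivial if its regular open algebra is atomic (every nonzero element lies above an atom; equivalently, forcing with it adds no new sets); a complete Boolean algebra is called trivial if it is atomic. (a) $RO(P)$ has no nontrivial regular subalgebra $Q$ with $Q\Vdash$ "$\kappa$ is regular". That is, if $Q$ is a regular subalgebra of $RO(P)$ and $[\![\check\kappa\text{ is regular}]\!]_Q=1$, then $Q$ is atomic; moreover, such a $Q$ adds no subsets of $\kappa$, i.e. $Q$ forces that every subset of $\check\kappa$ belongs to the ground model. (b) A nontrivial $\kappa$-centered forcing must add a subset of $\kappa$: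 if $R$ is a forcing notion that is a union of $\kappa$ many centered sets (sets each of whose nonempty finite subsets has a common lower bound in $R$), and $RO(R)$ forces that every subset of $\check\kappa$ belongs to the ground model, then $RO(R)$ is atomic. -/

import Mathlib

open Set Cardinal

universe u

/-! ### The complete Boolean algebra `RO(P)` of a forcing notion `P` -/

/-- Regular elements of a frame form a complete Boolean algebra. The Boolean operations are those
of `Heyting.Regular`; infima are computed in the frame, suprema are regularized. -/
noncomputable instance Heyting.Regular.instCompleteBooleanAlgebra {α : Type*} [Order.Frame α] :
    CompleteBooleanAlgebra (Heyting.Regular α) where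
  __ := (inferInstance : BooleanAlgebra (Heyting.Regular α))
  sSup := (Heyting.Regular.gi (α := α)).liftCompleteLattice.sSup
  sInf := (Heyting.Regular.gi (α := α)).liftCompleteLattice.sInf
  isLUB_sSup := (Heyting.Regular.gi (α := α)).liftCompleteLattice.isLUB_sSup
  isGLB_sInf := (Heyting.Regular.gi (α := α)).liftCompleteLattice.isGLB_sInf

/-- `RO(P)`: the regular open sets of the preorder `P`, where the open sets are the downward closed
ones (smaller conditions are stronger). -/
abbrev RO (P : Type u) [Preorder P] : Type u := Heyting.Regular (LowerSet P)

/-- The pseudo-complement of an open set `a` consists of the conditions with no extension in `a`. -/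
theorem RO.mem_compl_iff {P : Type u} [Preorder P] (a : LowerSet P) (p : P) :
    p ∈ aᶜ ↔ ∀ q ≤ p, q ∉ a := by
  have h1 : p ∈ aᶜ ↔ LowerSet.Iic p ≤ aᶜ := by simp
  rw [h1, le_compl_iff_disjoint_right, disjoint_iff_inf_le]
  constructor
  · intro h q hq hqa
    have : q ∈ LowerSet.Iic p ⊓ a := ⟨hq, hqa⟩
    exact h this
  · rintro h q ⟨hq, hqa⟩
    exact absurd hqa (h q hq)

/-- A regular (that is, complete) subalgebra of a complete Boolean algebra `B`: a Boolean
subalgebra closed under arbitrary suprema of `B`. -/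
structure RegularSubalgebra (B : Type u) [CompleteBooleanAlgebra B]
    extends BooleanSubalgebra B where
  sSup_mem' : ∀ S : Set B, S ⊆ carrier → sSup S ∈ carrier

namespace RegularSubalgebra

variable {B : Type u} [CompleteBooleanAlgebra B]

instance : CoeSort (RegularSubalgebra B) (Type u) := ⟨fun Q => Q.toBooleanSubalgebra⟩

theorem sInf_mem (Q : RegularSubalgebra B) (S : Set B) (hS : S ⊆ Q.carrier) :
    sInf S ∈ Q.carrier := by
  have h : sInf S = (sSup (compl '' S))ᶜ := by
    rw [sSup_image, compl_iSup]
    simp only [compl_iSup, compl_compl]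
    exact sInf_eq_iInf
  rw [h]
  refine Q.compl_mem' (Q.sSup_mem' _ ?_)
  rintro _ ⟨a, ha, rfl⟩
  exact Q.compl_mem' (hS ha)

/-- A regular subalgebra is a complete Boolean algebra under the operations of `B`. -/
noncomputable instance (Q : RegularSubalgebra B) : CompleteBooleanAlgebra Q where
  __ := (inferInstance : BooleanAlgebra Q.toBooleanSubalgebra)
  sSup S := ⟨sSup (Subtype.val '' S), Q.sSup_mem' _ (by rintro _ ⟨x, -, rfl⟩; exact x.2)⟩
  sInf S := ⟨sInf (Subtype.val '' S), Q.sInf_mem _ (by rintro _ ⟨x, -, rfl⟩; exact x.2)⟩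
  isLUB_sSup S := ⟨fun x hx => le_sSup (mem_image_of_mem Subtype.val hx),
    fun y hy => sSup_le (by rintro _ ⟨x, hx, rfl⟩; exact hy hx)⟩
  isGLB_sInf S := ⟨fun x hx => sInf_le (mem_image_of_mem Subtype.val hx),
    fun y hy => le_sInf (by rintro _ ⟨x, hx, rfl⟩; exact hy hx)⟩

end RegularSubalgebra

/-! ### Names and Boolean values -/

/-- The class `V^B` of `B`-names: a name is a small family of names, each with a value in `B`. -/
inductive BName (B : Type u) : Type (u + 1)
  | mk (ι : Type u) (elem : ι → BName B) (val : ι → B) : BName B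

namespace BName

variable {B : Type u} [CompleteBooleanAlgebra B]

/-- The Boolean value `⟦x = y⟧`. -/
noncomputable def eqv : BName B → BName B → B
  | mk _ a b, mk _ c d =>
    (⨅ i, b i ⇨ ⨆ j, d j ⊓ eqv (a i) (c j)) ⊓ (⨅ j, d j ⇨ ⨆ i, b i ⊓ eqv (a i) (c j))

/-- The Boolean value `⟦x ∈ y⟧`. -/
noncomputable def mem (x : BName B) : BName B → B
  | mk _ c d => ⨆ j, d j ⊓ eqv x (c j)

/-- The Boolean value `⟦x ⊆ y⟧`. -/
noncomputable def sub (x y : BName B) : B := ⨅ z : BName B, mem z x ⇨ mem z y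

/-- The name `{x, y}`. -/
def upair (x y : BName B) : BName B :=
  mk (ULift.{u} Bool) (fun i => if i.down then x else y) (fun _ => ⊤)

/-- The name of the (Kuratowski) ordered pair `(x, y) = {{x, x}, {x, y}}`. -/
def pair (x y : BName B) : BName B := upair (upair x x) (upair x y)

/-- The Boolean value of "`f` is a function from `a` to `c`". -/
noncomputable def isFun (f a c : BName B) : B :=
  (⨅ z : BName B, mem z f ⇨ ⨆ x : BName B, ⨆ y : BName B, mem x a ⊓ mem y c ⊓ eqv z (pair x y)) ⊓
  (⨅ x : BName B, mem x a ⇨ ⨆ y : BName B, mem (pair x y) f) ⊓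
  (⨅ x : BName B, ⨅ y : BName B, ⨅ y' : BName B,
    mem (pair x y) f ⊓ mem (pair x y') f ⇨ eqv y y')

/-- The Boolean value of "the range of `f` is bounded in the ordinal `c`". -/
noncomputable def isBdd (f c : BName B) : B :=
  ⨆ g : BName B, mem g c ⊓ ⨅ x : BName B, ⨅ y : BName B, mem (pair x y) f ⇨ mem y g

/-- The Boolean value of "`c` is regular", for an infinite limit ordinal `c`: for every `a ∈ c`,
every function from `a` to `c` is bounded in `c`. -/
noncomputable def isRegular (c : BName B) : B :=
  ⨅ a : BName B, mem a c ⇨ ⨅ f : BName B, isFun f a c ⇨ isBdd f c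

section Check

variable (B)

/-- For `a` in a well-order `K`, the canonical name of the ordinal which is the order type of the
set of predecessors of `a`. -/
def ordCheck {K : Type u} [LinearOrder K] [WellFoundedLT K] (a : K) : BName B :=
  mk (Iio a) (fun b => ordCheck b.1) (fun _ => ⊤)
termination_by wellFounded_lt.wrap a
decreasing_by exact b.2

/-- The canonical name of a set `A` of elements of `K` (viewed as ordinals). -/
def setCheck {K : Type u} [LinearOrder K] [WellFoundedLT K] (A : Set K) : BName B := mk A (fun a => ordCheck B a.1) (fun _ => ⊤)

/-- The canonical name of the order type of `K`; for `K = κ.ord.ToType` this is `κ̌`. -/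
def typeCheck (K : Type u) [LinearOrder K] [WellFoundedLT K] : BName B := setCheck B (univ : Set K)

end Check

end BName

/-- `B ⊩ "κ is regular"`, for an infinite cardinal `κ`. -/
def ForcesRegular (B : Type u) [CompleteBooleanAlgebra B] (κ : Cardinal.{u}) : Prop :=
  BName.isRegular (BName.typeCheck B κ.ord.ToType) = ⊤

/-- `B` adds no subsets of `κ`: it is forced that every subset of `κ` equals `Ǎ` for some ground
model set `A ⊆ κ`. -/
def AddsNoSubsets (B : Type u) [CompleteBooleanAlgebra B] (κ : Cardinal.{u}) : Prop :=
  (⨅ x : BName B, BName.sub x (BName.typeCheck B κ.ord.ToType) ⇨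
    ⨆ A : Set κ.ord.ToType, BName.eqv x (BName.setCheck B A)) = ⊤

/-- `R` is `κ`-centered: it is a union of `κ` many centered sets, where a set of conditions is
centered if each of its nonempty finite subsets has a common extension in `R`. -/
def IsKappaCentered (κ : Cardinal.{u}) (R : Type u) [Preorder R] : Prop :=
  ∃ C : κ.ord.ToType → Set R, (∀ p, ∃ a, p ∈ C a) ∧
    ∀ a, ∀ F : Finset R, F.Nonempty → (F : Set R) ⊆ C a → ∃ r, ∀ p ∈ F, r ≤ p

/-! ### Normal measures and Prikry forcing -/

/-- `U` is a normal measure on the uncountable cardinal `κ`: a nonprincipal, `κ`-complete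
ultrafilter on `κ` closed under diagonal intersections. -/
structure IsNormalMeasure (κ : Cardinal.{u}) (U : Ultrafilter κ.ord.ToType) : Prop where
  uncountable : ℵ₀ < κ
  nonprincipal : ∀ a, {a} ∉ U
  complete : CardinalInterFilter (U : Filter κ.ord.ToType) κ
  normal : ∀ X : κ.ord.ToType → Set κ.ord.ToType, (∀ a, X a ∈ U) →
    {b | ∀ a < b, b ∈ X a} ∈ U

/-- Conditions `⟨t, C⟩` of the Prikry forcing: a finite set `t ⊆ κ` (identified with its increasing
enumeration) and a set `C ∈ U` with `max t < min C`. -/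
structure PrikryForcing {κ : Cardinal.{u}} (U : Ultrafilter κ.ord.ToType) : Type u where
  stem : Finset κ.ord.ToType
  large : Set κ.ord.ToType
  large_mem : large ∈ U
  stem_lt : ∀ a ∈ stem, ∀ b ∈ large, a < b

/-- `⟨t, C⟩ ≤ ⟨s, D⟩` if `t` end-extends `s`, `t \ s ⊆ D` and `C ⊆ D`. -/
instance {κ : Cardinal.{u}} (U : Ultrafilter κ.ord.ToType) : PartialOrder (PrikryForcing U) where
  le q p := p.stem ⊆ q.stem ∧ (∀ a ∈ p.stem, ∀ b ∈ q.stem \ p.stem, a < b) ∧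
    (∀ b ∈ q.stem \ p.stem, b ∈ p.large) ∧ q.large ⊆ p.large
  le_refl p := ⟨subset_rfl, by simp, by simp, subset_rfl⟩
  le_trans r q p := by
    rintro ⟨h1, -, h3, h4⟩ ⟨k1, -, k3, k4⟩
    have key : ∀ b ∈ r.stem \ p.stem, b ∈ p.large := by
      intro b hb
      rw [Finset.mem_sdiff] at hb
      by_cases hq : b ∈ q.stem
      · exact k3 b (Finset.mem_sdiff.2 ⟨hq, hb.2⟩)
      · exact k4 (h3 b (Finset.mem_sdiff.2 ⟨hb.1, hq⟩))
    exact ⟨k1.trans h1, fun a ha b hb => p.stem_lt a ha b (key b hb), key, h4.trans k4⟩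
  le_antisymm p q := by
    rintro ⟨h1, -, -, h4⟩ ⟨k1, -, -, k4⟩
    obtain ⟨s, C, _, _⟩ := p
    obtain ⟨t, D, _, _⟩ := q
    obtain rfl : s = t := Finset.Subset.antisymm k1 h1
    obtain rfl : C = D := Set.Subset.antisymm h4 k4
    rfl

/-!
Write `K` for `κ.ord.ToType`. All statements about names reduce to the distributivity property
`DecidesDensely K B`: for every family `b : K → B`, the nonzero elements that decide each `b a` are
dense. It is equivalent to "`B` adds no subsets of `κ`"
(`AddsNoSubsets.decidesDensely`, `DecidesDensely.addsNoSubsets`).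

*Atomicity.* Suppose that the nonzero elements of `B` are covered by `κ` many upward closed families
`F i` of pairwise meeting elements. Pick `b i j ∈ F i \ F j` where possible. An element `c` deciding
all `b i j` lies in only one of the families, up to equality, so any two nonzero elements below `c`
lie in the same family and meet; hence `c` is an atom (`isAtomic_of_linked_cover`). The centered
pieces of a `κ`-centered forcing generate such a cover, and so do the sets of Prikry conditions with
a common stem; the latter cover restricts to every regular subalgebra.

*Preserving regularity implies distributivity.* Let `Q` be a regular subalgebra of `RO(P)` forcing
`κ` to be regular, and let `b : K → Q`, thought of as a subset `x` of `κ` in the extension by `Q`.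
By the Prikry property (`PrikryForcing.exists_stem_eq_decides`), every stem `t` guesses a set `A t`
in the ground model: each `b a` is decided by a condition with stem `t`. A diagonal intersection
gives a set `C ∈ U` such that, for Prikry sequences through `C`, the guess `A t` is correct up to the
next point after `t` of the Prikry sequence. If `x` differs from every ground model set, let `δ t` be
the least place where `x` and `A t` differ; it is at least the next point of the Prikry sequence
after each initial segment `t` of that sequence. The function `δ` belongs to the extension by `Q`,
where `κ` is regular, so closing off under `δ` gives a nondecreasing sequence `ν n` (`iterBound`)
bounded below `κ`. But by induction `ν` dominates the Prikry sequence
(`PrikryForcing.lt_of_forces_iterBound`), which is cofinal in `κ`: a contradiction.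

Regularity of `κ` in the extension is used through `ForcesRegular.le_iSup_iInf`, which avoids names:
it bounds fewer than `κ` many ordinals at once, each given by the increasing Boolean values of the
statements that it is less than `η`, for `η < κ`.
-/

/-! ### Forcing-style reasoning in a complete Boolean algebra -/

section Forcing

variable {B : Type u} [CompleteBooleanAlgebra B]

/-- To pass from `t ≤ ⨆ j, f j` to `t ≤ c`, one may strengthen `t` and pick an index `j`. -/
theorem le_of_le_iSup_of_forall {ι : Sort*} {f : ι → B} {t c : B} (h : t ≤ ⨆ j, f j)
    (h' : ∀ j, ∀ s ≤ t, s ≤ f j → s ≤ c) : t ≤ c := by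
  rw [← inf_eq_left.2 h, inf_iSup_eq]
  exact iSup_le fun j => h' j _ inf_le_left inf_le_right

theorem le_himp_iff_forall {t a b : B} : t ≤ a ⇨ b ↔ ∀ s ≤ t, s ≤ a → s ≤ b := by
  rw [le_himp_iff]
  exact ⟨fun h s hs ha => (le_inf hs ha).trans h, fun h => h _ inf_le_left inf_le_right⟩

/-- A nonzero element below a supremum meets one of its members. -/
theorem exists_inf_ne_bot_of_le_iSup {ι : Sort*} {f : ι → B} {t : B} (h : t ≤ ⨆ j, f j)
    (ht : t ≠ ⊥) : ∃ j, t ⊓ f j ≠ ⊥ := by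
  by_contra! hc
  rw [← inf_eq_left.2 h, inf_iSup_eq] at ht
  exact ht (by simp [hc])

end Forcing

/-! ### Equality and membership of names -/

namespace BName

variable {B : Type u} [CompleteBooleanAlgebra B]

theorem le_mem_mk {x : BName B} {ι : Type u} {c : ι → BName B} {d : ι → B} {t : B} (j : ι)
    (h : t ≤ d j) (h' : t ≤ eqv x (c j)) : t ≤ mem x (mk ι c d) := by
  rw [mem]
  exact le_iSup_of_le j (le_inf h h')

theorem le_eqv_mk_iff {ι ι' : Type u} {a : ι → BName B} {b : ι → B} {c : ι' → BName B}
    {d : ι' → B} {t : B} :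
    t ≤ eqv (mk ι a b) (mk ι' c d) ↔
      (∀ i, ∀ s ≤ t, s ≤ b i → s ≤ ⨆ j, d j ⊓ eqv (a i) (c j)) ∧
      (∀ j, ∀ s ≤ t, s ≤ d j → s ≤ ⨆ i, b i ⊓ eqv (a i) (c j)) := by
  rw [eqv, le_inf_iff, le_iInf_iff, le_iInf_iff]
  simp only [le_himp_iff_forall]

theorem eqv_refl (x : BName B) : eqv x x = ⊤ := by
  induction x with
  | mk ι a b ih =>
    refine top_le_iff.1 (le_eqv_mk_iff.2 ⟨fun i s _ h => ?_, fun i s _ h => ?_⟩) <;>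
    · refine le_iSup_of_le i ?_
      simpa [ih] using h

theorem le_eqv_refl {t : B} (x : BName B) : t ≤ eqv x x := by simp [eqv_refl]

theorem eqv_symm (x y : BName B) : eqv x y = eqv y x := by
  induction x generalizing y with
  | mk ι a b ih =>
    obtain ⟨ι', c, d⟩ := y
    simp only [eqv, ih]
    exact inf_comm _ _

theorem le_eqv_trans {x y z : BName B} {t : B} (h : t ≤ eqv x y) (h' : t ≤ eqv y z) :
    t ≤ eqv x z := by
  induction x generalizing y z t with
  | mk ι a b ih =>
    obtain ⟨ι', c, d⟩ := y
    obtain ⟨ι'', e, g⟩ := z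
    rw [le_eqv_mk_iff] at h h' ⊢
    constructor
    · intro i s hs hb
      refine le_of_le_iSup_of_forall (h.1 i s hs hb) fun j s' hs' hj => ?_
      rw [le_inf_iff] at hj
      refine le_of_le_iSup_of_forall (h'.1 j s' (hs'.trans hs) hj.1) fun k r hr hk => ?_
      rw [le_inf_iff] at hk
      exact le_iSup_of_le k (le_inf hk.1 (ih i (hr.trans hj.2) hk.2))
    · intro k s hs hb
      refine le_of_le_iSup_of_forall (h'.2 k s hs hb) fun j s' hs' hj => ?_
      rw [le_inf_iff] at hj
      refine le_of_le_iSup_of_forall (h.2 j s' (hs'.trans hs) hj.1) fun i r hr hi => ?_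
      rw [le_inf_iff] at hi
      exact le_iSup_of_le i (le_inf hi.1 (ih i hi.2 (hr.trans hj.2)))

theorem le_eqv_symm {x y : BName B} {t : B} (h : t ≤ eqv x y) : t ≤ eqv y x := by
  rwa [eqv_symm]

theorem le_mem_congr_left {x y z : BName B} {t : B} (h : t ≤ eqv x y) (h' : t ≤ mem x z) :
    t ≤ mem y z := by
  obtain ⟨ι, c, d⟩ := z
  rw [mem] at h'
  refine le_of_le_iSup_of_forall h' fun j s hs hj => ?_
  rw [le_inf_iff] at hj
  exact le_mem_mk j hj.1 (le_eqv_trans (le_eqv_symm (hs.trans h)) hj.2)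

theorem le_mem_congr_right {x y z : BName B} {t : B} (h : t ≤ eqv y z) (h' : t ≤ mem x y) :
    t ≤ mem x z := by
  obtain ⟨ι, c, d⟩ := z
  obtain ⟨ι', a, b⟩ := y
  rw [mem] at h'
  refine le_of_le_iSup_of_forall h' fun j s hs hj => ?_
  rw [le_inf_iff] at hj
  refine le_of_le_iSup_of_forall ((le_eqv_mk_iff.1 h).1 j s hs hj.1) fun k r hr hk => ?_
  rw [le_inf_iff] at hk
  exact le_mem_mk k hk.1 (le_eqv_trans (hr.trans hj.2) hk.2)

theorem le_mem_of_le_val {ι : Type u} {a : ι → BName B} {b : ι → B} {t : B} (i : ι)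
    (h : t ≤ b i) : t ≤ mem (a i) (mk ι a b) :=
  le_mem_mk i h (le_eqv_refl _)

/-- Extensionality: names with the same members, in the Boolean sense, are equal. -/
theorem le_eqv_of_forall {x y : BName B} {t : B} (h : ∀ z, ∀ s ≤ t, s ≤ mem z x → s ≤ mem z y)
    (h' : ∀ z, ∀ s ≤ t, s ≤ mem z y → s ≤ mem z x) : t ≤ eqv x y := by
  obtain ⟨ι, a, b⟩ := x
  obtain ⟨ι', c, d⟩ := y
  refine le_eqv_mk_iff.2 ⟨fun i s hs hi => ?_, fun j s hs hj => ?_⟩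
  · simpa only [mem] using h _ s hs (le_mem_of_le_val i hi)
  · simpa only [mem, eqv_symm] using h' _ s hs (le_mem_of_le_val j hj)

/-! ### Pairs -/

theorem mem_upair (z x y : BName B) : mem z (upair x y) = eqv z x ⊔ eqv z y := by
  simp only [upair, mem, top_inf_eq]
  apply le_antisymm
  · refine iSup_le fun ⟨i⟩ => ?_
    cases i <;> simp
  · exact sup_le (le_iSup_of_le ⟨true⟩ (by simp)) (le_iSup_of_le ⟨false⟩ (by simp))

theorem le_of_le_sup_of_forall {a b t c : B} (h : t ≤ a ⊔ b) (h1 : ∀ s ≤ t, s ≤ a → s ≤ c)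
    (h2 : ∀ s ≤ t, s ≤ b → s ≤ c) : t ≤ c := by
  rw [← inf_eq_left.2 h, inf_sup_left]
  exact sup_le (h1 _ inf_le_left inf_le_right) (h2 _ inf_le_left inf_le_right)

theorem le_upair_congr {x x' y y' : BName B} {t : B} (h : t ≤ eqv x x') (h' : t ≤ eqv y y') :
    t ≤ eqv (upair x y) (upair x' y') := by
  refine le_eqv_of_forall (fun z s hs hz => ?_) (fun z s hs hz => ?_) <;>
  · rw [mem_upair] at hz ⊢
    refine le_of_le_sup_of_forall hz (fun r hr hx => le_sup_of_le_left ?_)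
      (fun r hr hx => le_sup_of_le_right ?_)
    · exact le_eqv_trans hx ((hr.trans hs).trans (by first | exact h | exact le_eqv_symm h))
    · exact le_eqv_trans hx ((hr.trans hs).trans (by first | exact h' | exact le_eqv_symm h'))

theorem le_pair_congr {x x' y y' : BName B} {t : B} (h : t ≤ eqv x x') (h' : t ≤ eqv y y') :
    t ≤ eqv (pair x y) (pair x' y') :=
  le_upair_congr (le_upair_congr h h) (le_upair_congr h h')

theorem le_eqv_of_upair_self {x y z : BName B} {t : B} (h : t ≤ eqv (upair x y) (upair z z)) :
    t ≤ eqv x z ∧ t ≤ eqv y z := by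
  have hx : t ≤ mem x (upair x y) := by rw [mem_upair]; exact le_sup_of_le_left (le_eqv_refl _)
  have hy : t ≤ mem y (upair x y) := by rw [mem_upair]; exact le_sup_of_le_right (le_eqv_refl _)
  have hx' := le_mem_congr_right h hx
  have hy' := le_mem_congr_right h hy
  rw [mem_upair, sup_idem] at hx' hy'
  exact ⟨hx', hy'⟩

theorem le_fst_of_le_pair {x x' y y' : BName B} {t : B} (h : t ≤ eqv (pair x y) (pair x' y')) :
    t ≤ eqv x x' := by
  have h1 : t ≤ mem (upair x x) (pair x y) := by
    rw [pair, mem_upair]; exact le_sup_of_le_left (le_eqv_refl _)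
  have h2 := le_mem_congr_right h h1
  rw [pair, mem_upair] at h2
  refine le_of_le_sup_of_forall h2 (fun s _ hs => (le_eqv_of_upair_self hs).1) fun s _ hs => ?_
  exact le_eqv_symm (le_eqv_of_upair_self (le_eqv_symm hs)).1

/-- Under equality of `(x, y)` and `(x', y')`, the element `y` is `x'` or `y'`. -/
theorem le_snd_cases_of_le_pair {x x' y y' : BName B} {t : B}
    (h : t ≤ eqv (pair x y) (pair x' y')) : t ≤ eqv y x' ⊔ eqv y y' := by
  have h1 : t ≤ mem (upair x y) (pair x y) := by
    rw [pair, mem_upair]; exact le_sup_of_le_right (le_eqv_refl _)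
  have h2 := le_mem_congr_right h h1
  rw [pair, mem_upair] at h2
  refine le_of_le_sup_of_forall h2 (fun s _ hs => le_sup_of_le_left (le_eqv_of_upair_self hs).2)
    fun s _ hs => ?_
  rw [← mem_upair]
  refine le_mem_congr_right hs ?_
  rw [mem_upair]; exact le_sup_of_le_right (le_eqv_refl _)

theorem le_snd_of_le_pair {x x' y y' : BName B} {t : B} (h : t ≤ eqv (pair x y) (pair x' y')) :
    t ≤ eqv y y' := by
  refine le_of_le_sup_of_forall (le_snd_cases_of_le_pair h) (fun s hs h1 => ?_) fun s hs h1 => h1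
  refine le_of_le_sup_of_forall (le_snd_cases_of_le_pair (le_eqv_symm (hs.trans h)))
    (fun r hr h2 => ?_) fun r hr h2 => le_eqv_symm h2
  have h3 : r ≤ eqv x x' := (hr.trans hs).trans (le_fst_of_le_pair h)
  exact le_eqv_trans (hr.trans h1) (le_eqv_trans (le_eqv_symm h3) (le_eqv_symm h2))

/-! ### Canonical names -/

section Check

variable {K : Type u} [LinearOrder K] [WellFoundedLT K]

theorem mem_ordCheck (z : BName B) (a : K) :
    mem z (ordCheck B a) = ⨆ b : Iio a, eqv z (ordCheck B b.1) := by
  rw [ordCheck, mem]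
  simp

theorem mem_setCheck (z : BName B) (A : Set K) :
    mem z (setCheck B A) = ⨆ b : A, eqv z (ordCheck B b.1) := by
  rw [setCheck, mem]
  simp

theorem ordCheck_mem_ordCheck_of_lt {a b : K} (h : a < b) :
    mem (ordCheck B a) (ordCheck B b) = ⊤ := by
  rw [mem_ordCheck, ← top_le_iff]
  exact le_iSup_of_le ⟨a, h⟩ (le_eqv_refl _)

theorem ordCheck_mem_setCheck {a : K} {A : Set K} (h : a ∈ A) :
    mem (ordCheck B a) (setCheck B A) = ⊤ := by
  rw [mem_setCheck, ← top_le_iff]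
  exact le_iSup_of_le ⟨a, h⟩ (le_eqv_refl _)

theorem ordCheck_mem_typeCheck (a : K) : mem (ordCheck B a) (typeCheck B K) = ⊤ :=
  ordCheck_mem_setCheck (mem_univ a)

/-- No canonical ordinal name is a member of itself. -/
theorem ordCheck_mem_self (a : K) : mem (ordCheck B a) (ordCheck B a) = ⊥ := by
  induction a using WellFoundedLT.induction with
  | ind a ih =>
    refine le_bot_iff.1 (le_of_le_iSup_of_forall (mem_ordCheck _ a).le fun ⟨b, hb⟩ s hs h => ?_)
    rw [← ih b hb]
    have h1 : s ≤ mem (ordCheck B b) (ordCheck B a) := by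
      rw [ordCheck_mem_ordCheck_of_lt hb]; exact le_top
    exact le_mem_congr_right h h1

theorem eqv_ordCheck_of_ne {a b : K} (h : a ≠ b) : eqv (ordCheck B a) (ordCheck B b) = ⊥ := by
  wlog hab : a < b generalizing a b
  · rw [eqv_symm]
    exact this h.symm (lt_of_le_of_ne (not_lt.1 hab) h.symm)
  rw [← le_bot_iff, ← ordCheck_mem_self (B := B) a]
  refine le_mem_congr_right (le_eqv_symm le_rfl) ?_
  rw [ordCheck_mem_ordCheck_of_lt hab]; exact le_top

theorem ordCheck_mem_ordCheck_of_le {a b : K} (h : b ≤ a) :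
    mem (ordCheck B a) (ordCheck B b) = ⊥ := by
  rw [mem_ordCheck]
  exact iSup_eq_bot.2 fun ⟨c, hc⟩ => eqv_ordCheck_of_ne (lt_of_lt_of_le hc h).ne'

theorem ordCheck_mem_setCheck_of_notMem {a : K} {A : Set K} (h : a ∉ A) :
    mem (ordCheck B a) (setCheck B A) = ⊥ := by
  rw [mem_setCheck]
  exact iSup_eq_bot.2 fun ⟨c, hc⟩ => eqv_ordCheck_of_ne (by rintro rfl; exact h hc)

end Check

end BName

/-! ### Distributivity and the subsets of `κ` -/

/-- `B` is `K`-distributive with two values: the nonzero elements that decide every `b a` are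
dense, for each family `b : K → B`. -/
def DecidesDensely (K : Type u) (B : Type u) [CompleteBooleanAlgebra B] : Prop :=
  ∀ b : K → B, ∀ r : B, r ≠ ⊥ → ∃ c ≤ r, c ≠ ⊥ ∧ ∀ a, c ≤ b a ∨ c ≤ (b a)ᶜ

section Distributive

variable {B : Type u} [CompleteBooleanAlgebra B] {κ : Cardinal.{u}}

open BName

theorem AddsNoSubsets.decidesDensely (h : AddsNoSubsets B κ) :
    DecidesDensely κ.ord.ToType B := by
  intro b r hr
  -- the subset of `κ` whose members are the `a` with `b a` true
  let x : BName B := mk κ.ord.ToType (fun a => ordCheck B a) b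
  have hsub : sub x (typeCheck B κ.ord.ToType) = ⊤ := by
    refine top_le_iff.1 (le_iInf fun z => le_himp_iff_forall.2 fun s _ hs => ?_)
    refine le_of_le_iSup_of_forall (by simpa only [x, mem] using hs) fun a t _ ht => ?_
    rw [le_inf_iff] at ht
    refine le_mem_congr_left (le_eqv_symm ht.2) ?_
    rw [ordCheck_mem_typeCheck]; exact le_top
  have hx : r ≤ ⨆ A : Set κ.ord.ToType, eqv x (setCheck B A) := by
    have h1 := (iInf_eq_top.1 h) x
    rw [hsub, top_himp] at h1
    rw [h1]; exact le_top
  obtain ⟨A, hA⟩ := exists_inf_ne_bot_of_le_iSup hx hr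
  refine ⟨_, inf_le_left, hA, fun a => ?_⟩
  by_cases ha : a ∈ A
  · left
    have h1 : r ⊓ eqv x (setCheck B A) ≤ mem (ordCheck B a) x := by
      refine le_mem_congr_right (le_eqv_symm inf_le_right) ?_
      rw [ordCheck_mem_setCheck ha]; exact le_top
    refine h1.trans ?_
    simp only [x, mem]
    refine iSup_le fun a' => ?_
    by_cases haa : a = a'
    · subst haa; exact inf_le_left
    · rw [eqv_ordCheck_of_ne haa]; simp
  · right
    rw [le_compl_iff_disjoint_right, disjoint_iff_inf_le,
      ← ordCheck_mem_setCheck_of_notMem (B := B) ha]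
    refine le_mem_congr_right (inf_le_left.trans inf_le_right) ?_
    exact le_mem_of_le_val (a := fun a => ordCheck B a) a inf_le_right

theorem DecidesDensely.addsNoSubsets (h : DecidesDensely κ.ord.ToType B) :
    AddsNoSubsets B κ := by
  refine top_le_iff.1 (le_iInf fun x => le_himp_iff_forall.2 fun s _ hs => ?_)
  by_contra hne
  have hr : s ⊓ (⨆ A : Set κ.ord.ToType, eqv x (setCheck B A))ᶜ ≠ ⊥ := by
    rwa [← _root_.sdiff_eq, Ne, sdiff_eq_bot_iff]
  obtain ⟨c, hc, hc0, hdec⟩ := h (fun a => mem (ordCheck B a) x) _ hr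
  rw [le_inf_iff] at hc
  -- `c` decides `x` to be the following set
  let A : Set κ.ord.ToType := {a | c ≤ mem (ordCheck B a) x}
  suffices hA : c ≤ eqv x (setCheck B A) from
    hc0 (le_bot_iff.1 ((le_inf (hA.trans (le_iSup (fun A => eqv x (setCheck B A)) A)) hc.2).trans
      (inf_compl_self _).le))
  refine le_eqv_of_forall (fun z t ht hz => ?_) (fun z t ht hz => ?_)
  · have h1 : t ≤ mem z (typeCheck B κ.ord.ToType) :=
      le_himp_iff_forall.1 ((ht.trans hc.1).trans (hs.trans (iInf_le _ z))) t le_rfl hz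
    rw [typeCheck, mem_setCheck] at h1
    refine le_of_le_iSup_of_forall h1 fun ⟨a, _⟩ t' ht' ha => ?_
    rcases hdec a with hda | hda
    · rw [mem_setCheck]
      exact le_iSup_of_le ⟨a, hda⟩ ha
    · have h2 : t' ≤ mem (ordCheck B a) x := le_mem_congr_left ha (ht'.trans hz)
      exact (le_inf h2 ((ht'.trans ht).trans hda)).trans (by simp)
  · rw [mem_setCheck] at hz
    refine le_of_le_iSup_of_forall hz fun ⟨a, ha⟩ t' ht' h1 => ?_
    exact le_mem_congr_left (le_eqv_symm h1) ((ht'.trans ht).trans ha)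

/-! ### Linked covers -/

/-- If the nonzero elements are covered by `I` many upward closed linked families, and the nonzero
elements that decide `I × I` many statements are dense, then the algebra is atomic: choose
`b i j ∈ F i \ F j` whenever possible; an element `c` deciding all of them belongs to only one
family (up to equality), hence any two nonzero elements below `c` meet, so that `c` is an atom. -/
theorem isAtomic_of_linked_cover {I : Type*} (F : I → Set B)
    (hup : ∀ i, IsUpperSet (F i)) (hlink : ∀ i, ∀ a ∈ F i, ∀ b ∈ F i, a ⊓ b ≠ ⊥)
    (hcov : ∀ a : B, a ≠ ⊥ → ∃ i, a ∈ F i)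
    (hdec : ∀ b : I × I → B, ∀ r : B, r ≠ ⊥ → ∃ c ≤ r, c ≠ ⊥ ∧ ∀ a, c ≤ b a ∨ c ≤ (b a)ᶜ) :
    IsAtomic B := by
  classical
  refine ⟨fun r => or_iff_not_imp_left.2 fun hr => ?_⟩
  obtain ⟨c, hcr, hc0, hc⟩ := hdec
    (fun p => if h : ∃ b, b ∈ F p.1 ∧ b ∉ F p.2 then h.choose else ⊥) r hr
  have hsub : ∀ i j, c ∈ F i → c ∈ F j → F i ⊆ F j := by
    intro i j hi hj
    by_contra hne
    have h := Set.not_subset.1 hne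
    have hch := hc (i, j)
    simp only [dif_pos h] at hch
    rcases hch with h1 | h1
    · exact h.choose_spec.2 (hup j h1 hj)
    · exact hlink i _ hi _ h.choose_spec.1 (le_bot_iff.1
        ((inf_le_inf_right _ h1).trans (compl_inf_self _).le))
  have hmeet : ∀ d e : B, d ≤ c → e ≤ c → d ≠ ⊥ → e ≠ ⊥ → d ⊓ e ≠ ⊥ := by
    intro d e hd he hd0 he0
    obtain ⟨i, hi⟩ := hcov d hd0
    obtain ⟨j, hj⟩ := hcov e he0
    exact hlink j _ (hsub i j (hup i hd hi) (hup j he hj) hi) _ hj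
  refine ⟨c, ⟨hc0, fun d hd => ?_⟩, hcr⟩
  by_contra hd0
  have h1 : c ⊓ dᶜ ≠ ⊥ := by
    rw [← _root_.sdiff_eq, Ne, sdiff_eq_bot_iff]
    exact hd.not_ge
  refine hmeet d _ hd.le inf_le_left hd0 h1 ?_
  rw [inf_left_comm, inf_compl_self, inf_bot_eq]

theorem isAtomic_of_decidesDensely {I : Type u} (hκ : ℵ₀ ≤ κ) (hI : #I ≤ κ) (F : I → Set B)
    (hup : ∀ i, IsUpperSet (F i)) (hlink : ∀ i, ∀ a ∈ F i, ∀ b ∈ F i, a ⊓ b ≠ ⊥)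
    (hcov : ∀ a : B, a ≠ ⊥ → ∃ i, a ∈ F i) (hdec : DecidesDensely κ.ord.ToType B) :
    IsAtomic B := by
  refine isAtomic_of_linked_cover F hup hlink hcov fun b r hr => ?_
  have hle : #(I × I) ≤ #κ.ord.ToType := by
    rw [← mul_def, mk_ord_toType]
    exact (mul_le_mul' hI hI).trans (mul_eq_self hκ).le
  obtain ⟨e⟩ := hle
  obtain ⟨c, hcr, hc0, hc⟩ := hdec (Function.extend e b fun _ => ⊥) r hr
  refine ⟨c, hcr, hc0, fun a => ?_⟩
  simpa only [e.injective.extend_apply] using hc (e a)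

/-! ### Regularity of `κ` as a bounding property -/

/-- If `κ` is forced to be regular, then fewer than `κ` many ordinals below `κ` of the extension
have a common bound. Here `d a η` is the value of "the `a`-th ordinal is less than `η`". -/
theorem ForcesRegular.le_iSup_iInf_Iio (h : ForcesRegular B κ) (g : κ.ord.ToType)
    (d : Iio g → κ.ord.ToType → B) (hd : ∀ a, Monotone (d a)) (r : B)
    (hr : ∀ a, r ≤ ⨆ η, d a η) : r ≤ ⨆ η, ⨅ a, d a η := by
  -- `m a η` says that `η` is the least index at which `d a` holds
  let m : Iio g → κ.ord.ToType → B := fun a η => d a η ⊓ (⨆ η' : Iio η, d a η')ᶜ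
  have hm : ∀ a, r ≤ ⨆ η, m a η := by
    intro a
    have key : ∀ η, d a η ≤ ⨆ η, m a η := by
      intro η
      induction η using WellFoundedLT.induction with
      | ind η ih =>
        have h1 : d a η ≤ m a η ⊔ ⨆ η' : Iio η, d a η' := by
          simp only [m]
          rw [sup_inf_right, compl_sup_eq_top, inf_top_eq]
          exact le_sup_left
        exact h1.trans (sup_le (le_iSup (m a) η) (iSup_le fun η' => ih η'.1 η'.2))
    exact (hr a).trans (iSup_le key)
  have hdisj : ∀ a η η', η < η' → m a η ⊓ m a η' = ⊥ := by
    intro a η η' hlt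
    rw [← disjoint_iff]
    refine Disjoint.mono inf_le_left inf_le_right ?_
    exact (disjoint_compl_right).mono_left
      (le_iSup_of_le (f := fun ξ : Iio η' => d a ξ) ⟨η, hlt⟩ le_rfl)
  -- the name of the function sending `a` to the least such index
  let f : BName B := mk (Iio g × κ.ord.ToType)
    (fun p => pair (ordCheck B p.1.1) (ordCheck B p.2)) (fun p => m p.1 p.2)
  have hmem : ∀ x y : BName B, ∀ t, t ≤ mem (pair x y) f → ∀ c,
      (∀ a η, ∀ s ≤ t, s ≤ m a η → s ≤ eqv x (ordCheck B a.1) → s ≤ eqv y (ordCheck B η) →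
        s ≤ c) → t ≤ c := by
    intro x y t ht c hc
    refine le_of_le_iSup_of_forall (by simpa only [f, mem] using ht) fun p s hs hp => ?_
    rw [le_inf_iff] at hp
    exact hc p.1 p.2 s hs hp.1 (le_fst_of_le_pair hp.2) (le_snd_of_le_pair hp.2)
  have hfun : r ≤ isFun f (ordCheck B g) (typeCheck B κ.ord.ToType) := by
    refine le_inf (le_inf ?_ ?_) ?_
    · refine le_iInf fun z => le_himp_iff_forall.2 fun s _ hs => ?_
      refine le_of_le_iSup_of_forall (by simpa only [f, mem] using hs) fun p t _ hp => ?_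
      rw [le_inf_iff] at hp
      refine le_iSup_of_le (ordCheck B p.1.1) (le_iSup_of_le (ordCheck B p.2) ?_)
      rw [ordCheck_mem_typeCheck, ordCheck_mem_ordCheck_of_lt p.1.2]
      simpa using hp.2
    · refine le_iInf fun x => le_himp_iff_forall.2 fun s hs hx => ?_
      rw [mem_ordCheck] at hx
      refine le_of_le_iSup_of_forall hx fun a t ht ha => ?_
      refine le_of_le_iSup_of_forall ((ht.trans hs).trans (hm a)) fun η t' ht' hη => ?_
      refine le_iSup_of_le (ordCheck B η) ?_
      exact le_mem_mk (a, η) hη (le_pair_congr (ht'.trans ha) (le_eqv_refl _))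
    · refine le_iInf fun x => le_iInf fun y => le_iInf fun y' =>
        le_himp_iff_forall.2 fun s _ hs => ?_
      rw [le_inf_iff] at hs
      refine hmem x y s hs.1 _ fun a η t ht h1 h2 h3 => ?_
      refine hmem x y' t (ht.trans hs.2) _ fun a' η' t' ht' h1' h2' h3' => ?_
      by_cases haa : a = a'
      · subst haa
        rcases lt_trichotomy η η' with hlt | rfl | hlt
        · exact ((le_inf (ht'.trans h1) h1').trans (hdisj a η η' hlt).le).trans bot_le
        · exact le_eqv_trans (ht'.trans h3) (le_eqv_symm h3')
        · exact ((le_inf h1' (ht'.trans h1)).trans (hdisj a η' η hlt).le).trans bot_le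
      · have h4 : t' ≤ eqv (ordCheck B a.1) (ordCheck B a'.1) :=
          le_eqv_trans (le_eqv_symm (ht'.trans h2)) h2'
        rw [eqv_ordCheck_of_ne fun h => haa (Subtype.ext h)] at h4
        exact h4.trans bot_le
  have hbdd : r ≤ isBdd f (typeCheck B κ.ord.ToType) := by
    have h1 := (iInf_eq_top.1 h) (ordCheck B g)
    rw [ordCheck_mem_typeCheck, top_himp] at h1
    have h2 := (iInf_eq_top.1 h1) f
    exact hfun.trans (himp_eq_top_iff.1 h2)
  refine le_of_le_iSup_of_forall hbdd fun z s hs hz => ?_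
  rw [le_inf_iff, typeCheck, mem_setCheck] at hz
  refine le_of_le_iSup_of_forall hz.1 fun η t ht hη => ?_
  refine le_iSup_of_le η.1 (le_iInf fun a => ?_)
  refine le_of_le_iSup_of_forall ((ht.trans hs).trans (hm a)) fun η' t' ht' hη' => ?_
  by_cases hlt : η' < η.1
  · exact hη'.trans (inf_le_left.trans (hd a hlt.le))
  · have h3 : t' ≤ mem (pair (ordCheck B a.1) (ordCheck B η')) f :=
      le_mem_mk (a, η') hη' (le_eqv_refl _)
    have h4 : t' ≤ mem (ordCheck B η') z :=
      le_himp_iff_forall.1 ((ht'.trans ht).trans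
        (hz.2.trans ((iInf_le _ (ordCheck B a.1)).trans (iInf_le _ (ordCheck B η'))))) t' le_rfl h3
    have h5 := le_mem_congr_right (ht'.trans hη) h4
    rw [ordCheck_mem_ordCheck_of_le (not_lt.1 hlt)] at h5
    exact h5.trans bot_le

theorem exists_equiv_Iio_of_mk_lt {I : Type u} (hI : #I < κ) :
    ∃ g : κ.ord.ToType, Nonempty (I ≃ Iio g) := by
  have h : (#I).ord < Ordinal.type (α := κ.ord.ToType) (· < ·) := by
    simpa using Cardinal.ord_lt_ord.2 hI
  refine ⟨Ordinal.enum (α := κ.ord.ToType) (· < ·) ⟨_, h⟩, ?_⟩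
  refine Cardinal.eq.1 ?_
  have h1 := Ordinal.card_typein (r := ((· < ·) : κ.ord.ToType → κ.ord.ToType → Prop))
    (Ordinal.enum (α := κ.ord.ToType) (· < ·) ⟨_, h⟩)
  rw [Ordinal.typein_enum, card_ord] at h1
  exact h1.trans (Cardinal.mk_congr (Equiv.subtypeEquivRight fun _ => mem_Iio.symm))

theorem ForcesRegular.le_iSup_iInf (h : ForcesRegular B κ) {I : Type u} (hI : #I < κ)
    (d : I → κ.ord.ToType → B) (hd : ∀ a, Monotone (d a)) (r : B)
    (hr : ∀ a, r ≤ ⨆ η, d a η) : r ≤ ⨆ η, ⨅ a, d a η := by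
  obtain ⟨g, ⟨e⟩⟩ := exists_equiv_Iio_of_mk_lt hI
  have := h.le_iSup_iInf_Iio g (fun a => d (e.symm a)) (fun a => hd _) r fun a => hr _
  exact this.trans (iSup_mono fun η => (e.symm.surjective.iInf_comp fun a => d a η).le)

end Distributive

/-! ### The forcing relation of `RO(P)` -/

namespace RO

variable {P : Type u} [Preorder P]

/-- The forcing relation: `p` forces the Boolean value `b` if `p` belongs to the regular
open set `b`. -/
def Forces (p : P) (b : RO P) : Prop := p ∈ (b : LowerSet P)

theorem Forces.mono {p : P} {a b : RO P} (h : Forces p a) (hab : a ≤ b) : Forces p b :=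
  (Heyting.Regular.coe_le_coe.2 hab : (a : LowerSet P) ≤ b) h

theorem Forces.of_le {p q : P} {a : RO P} (h : Forces p a) (hq : q ≤ p) : Forces q a :=
  (a : LowerSet P).lower hq h

theorem forces_inf {p : P} {a b : RO P} : Forces p (a ⊓ b) ↔ Forces p a ∧ Forces p b := by
  simp only [Forces, Heyting.Regular.coe_inf]; exact Iff.rfl

theorem forces_compl {p : P} {a : RO P} : Forces p aᶜ ↔ ∀ q ≤ p, ¬ Forces q a := by
  simp only [Forces, Heyting.Regular.coe_compl]
  exact mem_compl_iff _ _

theorem not_forces_bot (p : P) : ¬ Forces p (⊥ : RO P) := by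
  simp [Forces]

theorem exists_forces {a : RO P} (h : a ≠ ⊥) : ∃ p, Forces p a := by
  by_contra! hc
  refine h (Heyting.Regular.coe_injective ?_)
  rw [Heyting.Regular.coe_bot]
  exact le_bot_iff.1 fun p hp => hc p hp

theorem forces_of_dense {p : P} {a : RO P} (h : ∀ q ≤ p, ∃ r ≤ q, Forces r a) : Forces p a := by
  rw [← compl_compl a, forces_compl]
  intro q hq hqa
  obtain ⟨r, hr, hra⟩ := h q hq
  exact forces_compl.1 hqa r hr hra

/-- The Boolean value generated by a condition `p`: it is the least one forced by `p`. -/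
theorem exists_forall_forces_iff (p : P) : ∃ e : RO P, ∀ b : RO P, Forces p b ↔ e ≤ b := by
  refine ⟨Heyting.Regular.toRegular (LowerSet.Iic p), fun b => ?_⟩
  rw [Heyting.Regular.gi.gc.le_iff_le, LowerSet.Iic_le]
  rfl

theorem exists_forces_of_forces_iSup {ι : Sort*} {f : ι → RO P} {p : P}
    (h : Forces p (⨆ i, f i)) : ∃ q ≤ p, ∃ i, Forces q (f i) := by
  by_contra! hc
  obtain ⟨e, he⟩ := exists_forall_forces_iff p
  have h1 : ⨆ i, f i ≤ eᶜ := iSup_le fun i => by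
    rw [le_compl_comm, ← he, forces_compl]
    exact fun q hq => hc q hq i
  rw [le_compl_comm, ← he, forces_compl] at h1
  exact h1 p le_rfl h

end RO

/-- Each centered piece of `R` generates an upward closed linked family in `RO(R)`, so that
`isAtomic_of_decidesDensely` applies. -/
theorem IsKappaCentered.isAtomic {κ : Cardinal.{u}} (hκ : ℵ₀ ≤ κ) {R : Type u} [Preorder R]
    (hR : IsKappaCentered κ R) (h : AddsNoSubsets (RO R) κ) : IsAtomic (RO R) := by
  classical
  obtain ⟨C, hC, hcent⟩ := hR
  refine isAtomic_of_decidesDensely hκ (mk_ord_toType κ).le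
    (fun i => {b | ∃ p ∈ C i, RO.Forces p b}) ?_ ?_ ?_ h.decidesDensely
  · rintro i a b hab ⟨p, hp, hpa⟩
    exact ⟨p, hp, hpa.mono hab⟩
  · rintro i a ⟨p, hp, hpa⟩ b ⟨q, hq, hqb⟩ hab
    obtain ⟨r, hr⟩ := hcent i {p, q} (by simp) (by simp [Set.insert_subset_iff, hp, hq])
    refine RO.not_forces_bot r (hab ▸ RO.forces_inf.2 ⟨hpa.of_le (hr p ?_), hqb.of_le (hr q ?_)⟩)
      <;> simp
  · intro a ha
    obtain ⟨p, hp⟩ := RO.exists_forces ha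
    obtain ⟨i, hi⟩ := hC p
    exact ⟨i, p, hi, hp⟩

/-! ### The Prikry property -/

theorem mk_Iic_toType_ord_lt {κ : Cardinal.{u}} (hκ : ℵ₀ ≤ κ) (a : κ.ord.ToType) :
    #(Iic a) < κ := by
  have := Cardinal.noMaxOrder hκ
  obtain ⟨b, hb⟩ := exists_gt a
  exact (mk_le_mk_of_subset (Iic_subset_Iio.2 hb)).trans_lt (by
    simpa using mk_Iio_lt b (by simp))

theorem mk_finset_lt {κ : Cardinal.{u}} (hκ : ℵ₀ < κ) {α : Type u} (h : #α < κ) :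
    #(Finset α) < κ := by
  rcases finite_or_infinite α with hα | hα
  · exact (lt_aleph0_of_finite _).trans hκ
  · rwa [mk_finset_of_infinite]

namespace IsNormalMeasure

variable {κ : Cardinal.{u}} {U : Ultrafilter κ.ord.ToType} (hU : IsNormalMeasure κ U)
include hU

theorem Ioi_mem (a : κ.ord.ToType) : Ioi a ∈ U := by
  have := hU.complete
  have h : (⋂ b : Iic a, {b.1}ᶜ) ∈ (U : Filter κ.ord.ToType) :=
    (Filter.cardinal_iInter_mem (mk_Iic_toType_ord_lt hU.uncountable.le a)).2 fun b =>
      Ultrafilter.compl_mem_iff_notMem.2 (hU.nonprincipal b)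
  refine Filter.mem_of_superset h fun b hb => ?_
  rw [mem_Ioi]
  by_contra hba
  exact (mem_iInter.1 hb ⟨b, not_lt.1 hba⟩) rfl

theorem setOf_forall_lt_mem (t : Finset κ.ord.ToType) : {b | ∀ a ∈ t, a < b} ∈ U := by
  have h : (⋂ a ∈ t, Ioi a) ∈ (U : Filter κ.ord.ToType) :=
    (Filter.biInter_finset_mem t).2 fun a _ => hU.Ioi_mem a
  refine Filter.mem_of_superset h fun b hb a ha => ?_
  exact mem_iInter₂.1 hb a ha

/-- Diagonal intersections of families indexed by finite sets. -/
theorem diagonal_finset_mem (D : Finset κ.ord.ToType → Set κ.ord.ToType) (hD : ∀ t, D t ∈ U) :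
    {b | ∀ t : Finset κ.ord.ToType, (∀ a ∈ t, a < b) → b ∈ D t} ∈ U := by
  have := hU.complete
  have hX : ∀ a : κ.ord.ToType,
      (⋂ t : Finset (Iic a), D (t.map (Function.Embedding.subtype _))) ∈ U := fun a =>
    (Filter.cardinal_iInter_mem (mk_finset_lt hU.uncountable
      (mk_Iic_toType_ord_lt hU.uncountable.le a))).2 fun t => hD _
  refine Filter.mem_of_superset (Filter.inter_mem (hD ∅) (hU.normal _ hX)) ?_
  rintro b ⟨hb0, hb⟩ t ht
  rcases t.eq_empty_or_nonempty with rfl | hne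
  · exact hb0
  have h1 := mem_iInter.1 (hb (t.max' hne) (ht _ (t.max'_mem hne)))
    (t.subtype (· ∈ Iic (t.max' hne)))
  rwa [Finset.subtype_map_of_mem fun x hx => mem_Iic.2 (t.le_max' x hx)] at h1

end IsNormalMeasure

namespace PrikryForcing

open RO

variable {κ : Cardinal.{u}} {U : Ultrafilter κ.ord.ToType}

theorem le_iff {q p : PrikryForcing U} : q ≤ p ↔ p.stem ⊆ q.stem ∧
    (∀ a ∈ p.stem, ∀ b ∈ q.stem \ p.stem, a < b) ∧ (∀ b ∈ q.stem \ p.stem, b ∈ p.large) ∧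
    q.large ⊆ p.large := Iff.rfl

/-- The condition with stem `t` whose large part consists of the elements of `C` above `t`. -/
noncomputable def ofSet (hU : IsNormalMeasure κ U) (t : Finset κ.ord.ToType) (C : Set κ.ord.ToType)
    (hC : C ∈ U) : PrikryForcing U where
  stem := t
  large := C ∩ {b | ∀ a ∈ t, a < b}
  large_mem := Filter.inter_mem hC (hU.setOf_forall_lt_mem t)
  stem_lt a ha _ hb := hb.2 a ha

/-- The extension of a condition by one element of its large part. -/
noncomputable def extend (hU : IsNormalMeasure κ U) (p : PrikryForcing U) (k : κ.ord.ToType) :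
    PrikryForcing U :=
  ofSet hU (insert k p.stem) p.large p.large_mem

theorem extend_le (hU : IsNormalMeasure κ U) {p : PrikryForcing U} {k : κ.ord.ToType}
    (hk : k ∈ p.large) : extend hU p k ≤ p := by
  have h : ∀ b ∈ (insert k p.stem) \ p.stem, b = k := by
    intro b hb
    rw [Finset.mem_sdiff, Finset.mem_insert] at hb
    tauto
  refine ⟨Finset.subset_insert _ _, fun a ha b hb => ?_, fun b hb => ?_, inter_subset_left⟩
  · rw [h b hb]; exact p.stem_lt a ha k hk
  · rw [h b hb]; exact hk

theorem compat_of_stem_eq {p q : PrikryForcing U} (h : p.stem = q.stem) :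
    ∃ r, r ≤ p ∧ r ≤ q :=
  ⟨⟨p.stem, p.large ∩ q.large, Filter.inter_mem p.large_mem q.large_mem,
      fun a ha b hb => p.stem_lt a ha b hb.1⟩,
    ⟨subset_rfl, by simp, by simp, inter_subset_left⟩,
    ⟨by simp [h], by simp [h], by simp [h], inter_subset_right⟩⟩

/-- If, for `U`-almost all `k`, some condition with stem `t ∪ {k}` forces `b`, then some condition
with stem `t` forces `b`: its large part is a diagonal intersection. -/
theorem exists_stem_eq_of_eventually (hU : IsNormalMeasure κ U) (b : RO (PrikryForcing U))
    (t : Finset κ.ord.ToType) {D : Set κ.ord.ToType} (hD : D ∈ U)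
    (h : ∀ k ∈ D, ∃ p : PrikryForcing U, p.stem = insert k t ∧ Forces p b) :
    ∃ p : PrikryForcing U, p.stem = t ∧ Forces p b := by
  classical
  have : Nonempty (PrikryForcing U) := ⟨ofSet hU ∅ univ Filter.univ_mem⟩
  choose! e hes heb using h
  have hX := hU.normal (fun k => if k ∈ D then (e k).large else univ) fun k => by
    split_ifs
    exacts [(e k).large_mem, Filter.univ_mem]
  refine ⟨ofSet hU t _ (Filter.inter_mem hD hX), rfl, forces_of_dense fun q hq => ?_⟩
  obtain ⟨j, hj⟩ := Ultrafilter.nonempty_of_mem q.large_mem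
  set r := extend hU q j
  have hrq : r ≤ q := extend_le hU hj
  have hrp := le_iff.1 (hrq.trans hq)
  have hne : (r.stem \ t).Nonempty := by
    refine ⟨j, Finset.mem_sdiff.2 ⟨Finset.mem_insert_self _ _, fun hjt => ?_⟩⟩
    exact lt_irrefl _ (q.stem_lt j ((le_iff.1 hq).1 hjt) j hj)
  -- the first new point of the stem of `r`
  set k := (r.stem \ t).min' hne
  have hk : k ∈ r.stem \ t := Finset.min'_mem _ _
  have hkr : k ∈ r.stem := (Finset.mem_sdiff.1 hk).1
  have hkD : k ∈ D := (hrp.2.2.1 k hk).1.1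
  have hlarge : ∀ c, k < c → c ∈ (ofSet hU t _ (Filter.inter_mem hD hX)).large →
      c ∈ (e k).large := by
    intro c hkc hc
    have := hc.1.2 k hkc
    rwa [if_pos hkD] at this
  have hnew : ∀ c ∈ r.stem \ insert k t, c ∈ r.stem \ t ∧ k < c := by
    intro c hc
    rw [Finset.mem_sdiff, Finset.mem_insert, not_or] at hc
    have hct : c ∈ r.stem \ t := Finset.mem_sdiff.2 ⟨hc.1, hc.2.2⟩
    exact ⟨hct, lt_of_le_of_ne (Finset.min'_le _ _ hct) (Ne.symm hc.2.1)⟩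
  refine ⟨r, hrq, (heb k hkD).of_le (le_iff.2 ?_)⟩
  rw [hes k hkD]
  refine ⟨Finset.insert_subset hkr hrp.1, fun a ha c hc => ?_, fun c hc => ?_, fun c hc => ?_⟩
  · rcases Finset.mem_insert.1 ha with rfl | ha
    · exact (hnew c hc).2
    · exact hrp.2.1 a ha c (hnew c hc).1
  · exact hlarge c (hnew c hc).2 (hrp.2.2.1 c (hnew c hc).1)
  · exact hlarge c (r.stem_lt k hkr c hc) (hrp.2.2.2 hc)

/-- The Prikry property: every Boolean value is decided by a condition with a prescribed stem. -/
theorem exists_stem_eq_decides (hU : IsNormalMeasure κ U) (b : RO (PrikryForcing U))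
    (t : Finset κ.ord.ToType) :
    ∃ p : PrikryForcing U, p.stem = t ∧ (Forces p b ∨ Forces p bᶜ) := by
  classical
  let Bad : Finset κ.ord.ToType → Prop := fun s =>
    ∀ p : PrikryForcing U, p.stem = s → ¬ Forces p b ∧ ¬ Forces p bᶜ
  by_contra! hc
  have hbad : Bad t := hc
  have hstep : ∀ s, Bad s → {k | Bad (insert k s)} ∈ U := by
    intro s hs
    by_contra hn
    rw [← Ultrafilter.compl_mem_iff_notMem] at hn
    have hn' : {k | ∃ p : PrikryForcing U, p.stem = insert k s ∧ Forces p b} ∪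
        {k | ∃ p : PrikryForcing U, p.stem = insert k s ∧ Forces p bᶜ} ∈ U := by
      refine Filter.mem_of_superset hn fun k hk => ?_
      by_contra hk'
      simp only [mem_union, mem_ofPred_eq, not_or, not_exists, not_and] at hk'
      exact hk fun p hp => ⟨hk'.1 p hp, hk'.2 p hp⟩
    rcases Ultrafilter.union_mem_iff.1 hn' with h | h
    · obtain ⟨p, hp, hpb⟩ := exists_stem_eq_of_eventually hU b s h fun k hk => hk
      exact (hs p hp).1 hpb
    · obtain ⟨p, hp, hpb⟩ := exists_stem_eq_of_eventually hU bᶜ s h fun k hk => hk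
      exact (hs p hp).2 hpb
  have hC := hU.diagonal_finset_mem (fun s => if Bad s then {k | Bad (insert k s)} else univ)
    fun s => by
      split_ifs with hs
      exacts [hstep s hs, Filter.univ_mem]
  have hunion : ∀ u : Finset κ.ord.ToType, (∀ k ∈ u, k ∈ (ofSet hU t _ hC).large) →
      Bad (t ∪ u) := by
    intro u
    induction u using Finset.induction_on_max with
    | empty => intro _; simpa using hbad
    | insert k u hku ih =>
      intro hu
      rw [Finset.forall_mem_insert] at hu
      have h1 := ih hu.2
      have h2 := hu.1.1 (t ∪ u) fun a ha => by
        rcases Finset.mem_union.1 ha with ha | ha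
        exacts [hu.1.2 a ha, hku a ha]
      rw [if_pos h1] at h2
      rw [Finset.union_insert]
      exact h2
  have hnone : ∀ q ≤ ofSet hU t _ hC, ¬ Forces q b := by
    intro q hq
    have h1 := hunion (q.stem \ t) (le_iff.1 hq).2.2.1
    rw [Finset.union_sdiff_of_subset (show t ⊆ q.stem from (le_iff.1 hq).1)] at h1
    exact (h1 q rfl).1
  exact (hbad _ rfl).2 (forces_compl.2 hnone)

end PrikryForcing

/-! ### Regular subalgebras of `RO(P)` for the Prikry forcing `P` -/

namespace RegularSubalgebra

variable {B : Type u} [CompleteBooleanAlgebra B] (Q : RegularSubalgebra B)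

theorem coe_iSup {ι : Type*} (f : ι → Q) : ((⨆ i, f i : Q) : B) = ⨆ i, (f i : B) := by
  have h : ((⨆ i, f i : Q) : B) = sSup (Subtype.val '' range f) := rfl
  rw [h, ← range_comp, sSup_range]
  rfl

end RegularSubalgebra

namespace PrikryForcing

open RO

variable {κ : Cardinal.{u}} {U : Ultrafilter κ.ord.ToType}

theorem mem_stem_of_lt {q p : PrikryForcing U} (h : q ≤ p) {j k : κ.ord.ToType}
    (hj : j ∈ q.stem) (hk : k ∈ p.stem) (hjk : j < k) : j ∈ p.stem := by
  by_contra hn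
  exact lt_asymm hjk ((le_iff.1 h).2.1 k hk j (Finset.mem_sdiff.2 ⟨hj, hn⟩))

theorem filter_stem_eq {q p : PrikryForcing U} (h : q ≤ p) {k : κ.ord.ToType}
    (hk : k ∈ p.stem) : q.stem.filter (· < k) = p.stem.filter (· < k) := by
  ext j
  simp only [Finset.mem_filter]
  exact ⟨fun hj => ⟨mem_stem_of_lt h hj.1 hk hj.2, hj.2⟩, fun hj => ⟨(le_iff.1 h).1 hj.1, hj.2⟩⟩

section Escape

variable {Q : RegularSubalgebra (RO (PrikryForcing U))}

/-- The values `⟦ν n ≤ v⟧` for the sequence of ordinals `ν` defined from values `d t v` of the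
statements `δ t < v`, where `t` ranges over the finite subsets of `κ`: `ν 0` is a strict upper bound
of `s`, and `ν (n + 1)` is at least `ν n` and exceeds `δ t` for every finite `t ⊆ ν n`. -/
noncomputable def iterBound (s : Finset κ.ord.ToType)
    (d : Finset κ.ord.ToType → κ.ord.ToType → Q) : ℕ → κ.ord.ToType → Q
  | 0, v => ⨆ _ : ∀ a ∈ s, a < v, ⊤
  | n + 1, v => ⨆ v' : Iic v, iterBound s d n v' ⊓
      ⨅ t : Finset (Iio v'.1), d (t.map (Function.Embedding.subtype _)) v

variable {s : Finset κ.ord.ToType} {d : Finset κ.ord.ToType → κ.ord.ToType → Q}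

theorem iterBound_monotone (hd : ∀ t, Monotone (d t)) (n : ℕ) : Monotone (iterBound s d n) := by
  intro v w hvw
  cases n with
  | zero => exact iSup_mono' fun h => ⟨fun a ha => (h a ha).trans_le hvw, le_rfl⟩
  | succ n =>
    exact iSup_le fun v' => le_iSup_of_le ⟨v'.1, v'.2.trans hvw⟩
      (inf_le_inf_left _ (iInf_mono fun t => hd _ hvw))

/-- Regularity of `κ` makes each `ν n` exist below `κ`: there are fewer than `κ` many finite subsets
of `ν n`, so the ordinals `δ t` for these `t` have a common bound. -/
theorem le_iSup_iterBound (hκ : ℵ₀ < κ) (hQ : ForcesRegular Q κ) (hd : ∀ t, Monotone (d t))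
    {r : Q} (hr : ∀ t, r ≤ ⨆ v, d t v) (n : ℕ) : r ≤ ⨆ v, iterBound s d n v := by
  induction n with
  | zero =>
    have := Cardinal.noMaxOrder hκ.le
    have hne : Nonempty κ.ord.ToType := by
      rw [← mk_ne_zero_iff, mk_ord_toType]
      exact (aleph0_pos.trans hκ).ne'
    obtain ⟨m, hm⟩ := s.exists_le
    obtain ⟨v, hv⟩ := exists_gt m
    refine le_iSup_of_le v (le_iSup_of_le (fun a ha => (hm a ha).trans_lt hv) le_top)
  | succ n ih =>
    refine le_of_le_iSup_of_forall ih fun v' t ht hv' => ?_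
    have hI : #(Finset (Iio v')) < κ := mk_finset_lt hκ (by simpa using mk_Iio_lt v' (by simp))
    have h1 := hQ.le_iSup_iInf hI
      (fun t => d (t.map (Function.Embedding.subtype _))) (fun t => hd _) r fun t => hr _
    refine le_of_le_iSup_of_forall (ht.trans h1) fun v t' ht' hv => ?_
    refine le_iSup_of_le (max v v') (le_iSup_of_le ⟨v', mem_Iic.2 (le_max_right _ _)⟩ ?_)
    exact le_inf (ht'.trans hv') (hv.trans (iInf_mono fun t => hd _ (le_max_left _ _)))

/-- If each `δ t` is forced to be at least the next point of the Prikry sequence after `t`, then the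
sequence `ν` dominates the Prikry sequence. Here the hypothesis is stated for conditions below `p`
and for the initial segments `t` of their stems beyond the stem of `p`. -/
theorem lt_of_forces_iterBound {p : PrikryForcing U}
    (hp : ∀ q ≤ p, ∀ k ∈ q.stem, k ∉ p.stem → ∀ v ≤ k,
      ¬ Forces q (d (q.stem.filter (· < k)) v : RO (PrikryForcing U)))
    (n : ℕ) {v : κ.ord.ToType} {q : PrikryForcing U} (hq : q ≤ p)
    (hqv : Forces q (iterBound p.stem d n v : RO (PrikryForcing U)))
    {k : κ.ord.ToType} (hk : k ∈ q.stem)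
    (hcard : (q.stem.filter (· < k)).card < p.stem.card + n) : k < v := by
  induction n generalizing v q k with
  | zero =>
    have hks : k ∈ p.stem := by
      by_contra hks
      refine hcard.not_ge (Finset.card_le_card fun a ha => Finset.mem_filter.2
        ⟨(le_iff.1 hq).1 ha, (le_iff.1 hq).2.1 a ha k (Finset.mem_sdiff.2 ⟨hk, hks⟩)⟩)
    by_contra hkv
    have hfalse : ¬ ∀ a ∈ p.stem, a < v := fun h => hkv (h k hks)
    rw [iterBound, iSup_neg hfalse] at hqv
    exact not_forces_bot q hqv
  | succ n ih =>
    rw [iterBound, RegularSubalgebra.coe_iSup] at hqv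
    obtain ⟨q', hq', ⟨v', hv'⟩, hf⟩ := exists_forces_of_forces_iSup hqv
    have hf1 := hf.mono (show _ ≤ ((iterBound p.stem d n v' : Q) : RO (PrikryForcing U)) from
      Subtype.coe_le_coe.2 inf_le_left)
    have hk' : k ∈ q'.stem := (le_iff.1 hq').1 hk
    rw [← filter_stem_eq hq' hk] at hcard
    set t := q'.stem.filter (· < k)
    have htv : ∀ j ∈ t, j ∈ Iio v' := by
      intro j hj
      have hj' := Finset.mem_filter.1 hj
      refine ih (hq'.trans hq) hf1 hj'.1 (lt_of_lt_of_le (Finset.card_lt_card ?_)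
        (Nat.lt_succ_iff.1 hcard))
      refine Finset.ssubset_iff_subset_ne.2 ⟨fun i hi => ?_, fun h => ?_⟩
      · have hi' := Finset.mem_filter.1 hi
        exact Finset.mem_filter.2 ⟨hi'.1, hi'.2.trans hj'.2⟩
      · rw [← h] at hj
        exact lt_irrefl _ (Finset.mem_filter.1 hj).2
    have hf2 := hf.mono (show _ ≤ ((d t v : Q) : RO (PrikryForcing U)) from
      Subtype.coe_le_coe.2 (inf_le_right.trans ((iInf_le _ (t.subtype (· ∈ Iio v'))).trans
        (by rw [Finset.subtype_map_of_mem htv]))))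
    by_cases hks : k ∈ p.stem
    · refine (ih (hq'.trans hq) hf1 hk' ?_).trans_le hv'
      refine lt_of_lt_of_le (Finset.card_lt_card ?_) (Nat.le_add_right _ _)
      refine Finset.ssubset_iff_subset_ne.2 ⟨fun i hi => ?_, fun h => ?_⟩
      · have hi' := Finset.mem_filter.1 hi
        exact mem_stem_of_lt (hq'.trans hq) hi'.1 hks hi'.2
      · rw [← h] at hks
        exact lt_irrefl _ (Finset.mem_filter.1 hks).2
    · by_contra hkv
      exact hp q' (hq'.trans hq) k hk' hks v (not_lt.1 hkv) hf2

end Escape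

/-- A regular subalgebra of `RO(P)` that preserves the regularity of `κ` densely decides each
sequence of `κ` many Boolean values. -/
theorem decidesDensely_of_forcesRegular (hU : IsNormalMeasure κ U)
    (Q : RegularSubalgebra (RO (PrikryForcing U))) (hQ : ForcesRegular Q κ) :
    DecidesDensely κ.ord.ToType Q := by
  classical
  have hκ := hU.uncountable
  have := Cardinal.noMaxOrder hκ.le
  intro b r hr
  by_contra! hc
  choose e hes hedec using fun (a : κ.ord.ToType) (t : Finset κ.ord.ToType) =>
    exists_stem_eq_decides hU (b a : RO (PrikryForcing U)) t
  -- `y t a` says that the stem `t` decides `b a` incorrectly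
  let y : Finset κ.ord.ToType → κ.ord.ToType → Q := fun t a =>
    if Forces (e a t) (b a : RO (PrikryForcing U)) then (b a)ᶜ else b a
  have hy : ∀ t a, Forces (e a t) ((y t a : RO (PrikryForcing U)))ᶜ := by
    intro t a
    by_cases h : Forces (e a t) (b a : RO (PrikryForcing U))
    · simp only [y, if_pos h]
      change Forces (e a t) ((b a : RO (PrikryForcing U))ᶜ)ᶜ
      rwa [compl_compl]
    · simp only [y, if_neg h]
      exact (hedec a t).resolve_left h
  have hdis : ∀ t, r ≤ ⨆ a, y t a := by
    intro t
    by_contra hn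
    rw [← sdiff_eq_bot_iff, _root_.sdiff_eq] at hn
    obtain ⟨a, ha1, ha2⟩ := hc _ inf_le_left hn
    have h1 : r ⊓ (⨆ a, y t a)ᶜ ≤ (y t a)ᶜ :=
      inf_le_right.trans (compl_le_compl (le_iSup (y t) a))
    simp only [y] at h1
    split_ifs at h1
    · rw [compl_compl] at h1
      exact ha1 h1
    · exact ha2 h1
  -- the values of the statements "the least `a` such that `t` decides `b a` incorrectly is below `v`"
  let d : Finset κ.ord.ToType → κ.ord.ToType → Q := fun t v => ⨆ a : Iio v, y t a
  have hd : ∀ t, Monotone (d t) := fun t v w hvw =>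
    iSup_le fun a => le_iSup_of_le (f := fun a : Iio w => y t a) ⟨a.1, a.2.trans_le hvw⟩ le_rfl
  have hrd : ∀ t, r ≤ ⨆ v, d t v := fun t => (hdis t).trans <| iSup_le fun a => by
    obtain ⟨v, hv⟩ := exists_gt a
    exact le_iSup_of_le v (le_iSup_of_le (f := fun a : Iio v => y t a) ⟨a, hv⟩ le_rfl)
  -- a set whose part above `a` and `t` is contained in the large part of `e a t`, for all `a`, `t`
  have hC := hU.diagonal_finset_mem
    (fun u => ⋂ t ∈ u.powerset, ⋂ a ∈ u, (e a t).large) fun u =>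
      (Filter.biInter_finset_mem _).2 fun t _ => (Filter.biInter_finset_mem _).2 fun a _ =>
        (e a t).large_mem
  set C := {k | ∀ u : Finset κ.ord.ToType, (∀ a ∈ u, a < k) →
    k ∈ ⋂ t ∈ u.powerset, ⋂ a ∈ u, (e a t).large}
  have hCe : ∀ k ∈ C, ∀ a < k, ∀ t : Finset κ.ord.ToType, (∀ j ∈ t, j < k) →
      k ∈ (e a t).large := by
    intro k hk a ha t ht
    have h1 := hk (insert a t) ((Finset.forall_mem_insert _ _ _).2 ⟨ha, ht⟩)
    exact mem_iInter₂.1 (mem_iInter₂.1 h1 t (Finset.mem_powerset.2 (Finset.subset_insert _ _))) a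
      (Finset.mem_insert_self _ _)
  obtain ⟨p₀, hp₀⟩ := exists_forces (a := (r : RO (PrikryForcing U)))
    fun h => hr (Subtype.ext h)
  let p : PrikryForcing U := ⟨p₀.stem, p₀.large ∩ C, Filter.inter_mem p₀.large_mem hC,
    fun a ha c hc => p₀.stem_lt a ha c hc.1⟩
  have hpp₀ : p ≤ p₀ := ⟨subset_rfl, by simp [p], by simp [p], inter_subset_left⟩
  have hkey : ∀ q ≤ p, ∀ k ∈ q.stem, k ∉ p.stem → ∀ v ≤ k,
      ¬ Forces q (d (q.stem.filter (· < k)) v : RO (PrikryForcing U)) := by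
    intro q hq k hk hkp v hvk hf
    simp only [d, RegularSubalgebra.coe_iSup] at hf
    obtain ⟨q', hq', ⟨a, hav⟩, hf⟩ := exists_forces_of_forces_iSup hf
    rw [← filter_stem_eq hq' hk] at hf
    have hk' := (le_iff.1 hq').1 hk
    have hak : a < k := lt_of_lt_of_le hav hvk
    set t := q'.stem.filter (· < k)
    have htk : ∀ j ∈ t, j < k := fun j hj => (Finset.mem_filter.1 hj).2
    refine forces_compl.1 (hy t a) q' (le_iff.2 ?_) hf
    have hq'p := le_iff.1 (hq'.trans hq)
    have hge : ∀ c ∈ q'.stem \ t, k ≤ c ∧ c ∈ C := by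
      intro c hc
      rw [Finset.mem_sdiff, Finset.mem_filter, not_and, not_lt] at hc
      have hkc := hc.2 hc.1
      refine ⟨hkc, (hq'p.2.2.1 c (Finset.mem_sdiff.2 ⟨hc.1, fun hcp => ?_⟩)).2⟩
      exact hkc.not_gt (hq'p.2.1 c hcp k (Finset.mem_sdiff.2 ⟨hk', hkp⟩))
    rw [hes]
    refine ⟨Finset.filter_subset _ _, fun j hj c hc => (htk j hj).trans_le (hge c hc).1,
      fun c hc => ?_, fun c hc => ?_⟩
    · exact hCe c (hge c hc).2 a (hak.trans_le (hge c hc).1) t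
        fun j hj => (htk j hj).trans_le (hge c hc).1
    · have hkc : k < c := q'.stem_lt k hk' c hc
      exact hCe c (hq'p.2.2.2 hc).2 a (hak.trans hkc) t fun j hj => (htk j hj).trans hkc
  -- the sequence built from `d` is bounded by some `v < κ`, yet it dominates the Prikry sequence
  have hbdd : r ≤ ⨆ v, ⨅ n : ULift.{u} ℕ, iterBound p.stem d n.down v :=
    hQ.le_iSup_iInf (by simpa using hκ) (fun n : ULift.{u} ℕ => iterBound p.stem d n.down)
      (fun n => iterBound_monotone hd n.down) r fun n => le_iSup_iterBound hκ hQ hd hrd n.down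
  have hpf := (hp₀.of_le hpp₀).mono (Subtype.coe_le_coe.2 hbdd)
  rw [RegularSubalgebra.coe_iSup] at hpf
  obtain ⟨q, hq, v, hqv⟩ := exists_forces_of_forces_iSup hpf
  obtain ⟨k, hkq, hvk⟩ := Ultrafilter.nonempty_of_mem
    (Filter.inter_mem q.large_mem (hU.Ioi_mem v))
  have hq' := extend_le hU hkq
  refine lt_asymm hvk (lt_of_forces_iterBound hkey
    (((extend hU q k).stem.filter (· < k)).card + 1) (hq'.trans hq)
    ((hqv.of_le hq').mono (Subtype.coe_le_coe.2 (iInf_le _ (ULift.up _))))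
    (Finset.mem_insert_self _ _) (by omega))

/-- The conditions with a common stem generate a linked family, so that `RO(P)` and its regular
subalgebras are covered by `κ` many linked families. -/
theorem isAtomic_of_decidesDensely (hU : IsNormalMeasure κ U)
    (Q : RegularSubalgebra (RO (PrikryForcing U))) (hQ : DecidesDensely κ.ord.ToType Q) :
    IsAtomic Q := by
  have hκ := hU.uncountable.le
  have hinf : Infinite κ.ord.ToType := infinite_iff.2 (by simpa using hκ)
  refine _root_.isAtomic_of_decidesDensely hκ (I := Finset κ.ord.ToType) (by simp)
    (fun t => {b | ∃ p : PrikryForcing U, p.stem = t ∧ Forces p (b : RO (PrikryForcing U))})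
    ?_ ?_ ?_ hQ
  · rintro t a b hab ⟨p, hp, hpa⟩
    exact ⟨p, hp, hpa.mono hab⟩
  · rintro t a ⟨p, hp, hpa⟩ b ⟨q, hq, hqb⟩ hab
    obtain ⟨r, hrp, hrq⟩ := compat_of_stem_eq (hp.trans hq.symm)
    have h1 : Forces r ((a ⊓ b : Q) : RO (PrikryForcing U)) :=
      forces_inf.2 ⟨hpa.of_le hrp, hqb.of_le hrq⟩
    rw [hab] at h1
    exact not_forces_bot r h1
  · intro a ha
    obtain ⟨p, hp⟩ := exists_forces (a := (a : RO (PrikryForcing U))) fun h => ha (Subtype.ext h)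
    exact ⟨p.stem, p, rfl, hp⟩

end PrikryForcing

theorem claim2 (κ : Cardinal.{u}) (U : Ultrafilter κ.ord.ToType) (hU : IsNormalMeasure κ U) :
    (∀ Q : RegularSubalgebra (RO (PrikryForcing U)),
      ForcesRegular Q κ → AddsNoSubsets Q κ ∧ IsAtomic Q) ∧
    (∀ (R : Type u) [Preorder R],
      IsKappaCentered κ R → AddsNoSubsets (RO R) κ → IsAtomic (RO R)) := by
  refine ⟨fun Q hQ => ?_, fun R _ hR h => hR.isAtomic hU.uncountable.le h⟩
  have h := PrikryForcing.decidesDensely_of_forcesRegular hU Q hQ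
  exact ⟨h.addsNoSubsets, PrikryForcing.isAtomic_of_decidesDensely hU Q h⟩
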